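/- Let $p$ be a prime number. For a profinite group $\Gamma$ write $H^2(\Gamma)=H^2(\Gamma,\mathbb Z/p)$ for the second continuous cohomology group with trivial action on the discrete group $\mathbb Z/p$. Fix a nonempty set $\Omega$ of central extensions of profinite groups $$\omega:\quad 0\to\mathbb Z/p\to U_\omega\xrightarrow{\lambda_\omega}\bar U_\omega\to1$$ such that for every $\omega\in\Omega$: (I) there are finitely many continuous homomorphisms $\gamma_1,\dots,\gamma_n\colon\bar U_\omega\to U_\omega$ with $\bigcap_{i=1}^n\operatorname{Ker}(\gamma_i)=\{1\}$; (II) $\mathbb Z/p$ embeds in $\bar U_\omega$. Let $\alpha_\omega\in H^2(\bar U_\omega)$ be the class of the extension $\omega$. For a profinite group $G$ let $T(G)$ (resp. $\bar T(G)$) be the intersection of the kernels of all continuous homomorphisms $G\to U_\omega$ (resp. $G\to\bar U_\omega$), where $\omega$ ranges over $\Omega$. Given closed normal subgroups $N_1\le N_2$ of $G$ contained in $\bar T(G)$, a continuous homomorphism $\bar\rho\colon G/N_2\to\bar U_\omega$ is called liftable if there is a continuous homomorphism $\rho\colon G\to U_\omega$ such that $\lambda_\omega\circ\rho$ is the composition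 of the projection $G\to G/N_2$ with $\bar\rho$; the corresponding elements $\bar\rho^*(\alpha_\omega)\in H^2(G/N_2)$, for $\omega\in\Omega$ and $\bar\rho$ liftable, are called liftable pullbacks. Let $\inf\colon H^2(G/N_2)\to H^2(G/N_1)$ be the inflation map. Let $C_G(N_1,N_2)$ be the kernel of $\inf$ on the subgroup of $H^2(G/N_2)$ generated by all liftable pullbacks, and let $B_G(N_1,N_2)$ be the subgroup generated by those liftable pullbacks that lie in $\operatorname{Ker}(\inf)$. The kernel generating condition for $N_1,N_2$ is the equality $B_G(N_1,N_2)=C_G(N_1,N_2)$. **Theorem.** Let $N$ be a closed normal subgroup of a profinite group $G$ with $N\le\bar T(G)$, and let $\pi\colon G\to G/N$ be the projection. The following conditions are equivalent: (a) $\pi[T(G)]=T(G/N)$; (b) the kernel generating condition $B_G(N,\bar T(G))=C_G(N,\bar T(G))$ holds; (c) $\langle\Pi\cap\operatorname{Ker}(\inf)\rangle=\langle\Pi\rangle\cap\operatorname{Ker}(\inf)$, where $\Pi$ is the set of all liftable pullbacks $\bar\rho^*(\alpha_\omega)$ in $H^2(G/\bar T(G))$, $\inf\colon H^2(G/\bar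 T(G))\to H^2(G/N)$ is the inflation map, and $\langle\cdot\rangle$ denotes the subgroup generated. -/

import Mathlib

universe u v

namespace KernelGenerating

/-! ### Second continuous cohomology with trivial coefficients `ℤ/p` -/

section Cohomology

variable (p : ℕ) (G : Type*) [Group G] [TopologicalSpace G] [IsTopologicalGroup G]

/-- Continuous inhomogeneous `2`-cocycles of `G` with values in the discrete trivial
`G`-module `ℤ/p`. -/
def cocycles₂ : AddSubgroup C(G × G, ZMod p) where
  carrier := {f | ∀ g h j : G, f (h, j) + f (g, h * j) = f (g * h, j) + f (g, h)}
  zero_mem' := by intro g h j; simp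
  add_mem' := by
    intro a b ha hb g h j
    have h1 := ha g h j
    have h2 := hb g h j
    simp only [ContinuousMap.add_apply]
    linear_combination h1 + h2
  neg_mem' := by
    intro a ha g h j
    have h1 := ha g h j
    simp only [ContinuousMap.neg_apply]
    linear_combination -h1

/-- The coboundary `(d x)(g, h) = x h - x (g * h) + x g` of a continuous `1`-cochain. -/
def d₁ : C(G, ZMod p) →+ cocycles₂ p G where
  toFun x := ⟨⟨fun a => x a.2 - x (a.1 * a.2) + x a.1, by fun_prop⟩, by
    intro g h j
    simp only [ContinuousMap.coe_mk, mul_assoc]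
    ring⟩
  map_zero' := by ext a; simp
  map_add' x y := by
    ext a
    simp only [ContinuousMap.coe_mk, ContinuousMap.add_apply, AddSubgroup.coe_add]
    ring

/-- `H²(G) = H²(G, ℤ/p)`: continuous `2`-cocycles modulo coboundaries of continuous
`1`-cochains. -/
abbrev H2 : Type _ := cocycles₂ p G ⧸ (d₁ p G).range

variable {p G} {K : Type*} [Group K] [TopologicalSpace K] [IsTopologicalGroup K]

/-- Pullback of cocycles along a continuous homomorphism. -/
def cocycles₂Map (φ : K →ₜ* G) : cocycles₂ p G →+ cocycles₂ p K where
  toFun f := ⟨⟨fun a => f.1 (φ a.1, φ a.2), by fun_prop⟩, by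
    intro g h j
    simpa using f.2 (φ g) (φ h) (φ j)⟩
  map_zero' := by ext a; simp
  map_add' x y := by ext a; simp

/-- The pullback `φ^* : H²(G) → H²(K)` along a continuous homomorphism `φ : K → G`. -/
def H2Map (φ : K →ₜ* G) : H2 p G →+ H2 p K :=
  QuotientAddGroup.map _ _ (cocycles₂Map φ) (by
    rintro _ ⟨x, rfl⟩
    refine ⟨x.comp ⟨φ, φ.continuous_toFun⟩, ?_⟩
    ext a
    simp [d₁, cocycles₂Map])

end Cohomology

/-! ### Central extensions of profinite groups by `ℤ/p` -/

/-- A central extension `0 → ℤ/p → U → Ubar → 1` of profinite groups.  (The inclusion of `ℤ/p` is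
automatically continuous, as `ℤ/p` is discrete.) -/
structure CentralExtension (p : ℕ) where
  /-- The group `U` in the middle. -/
  U : ProfiniteGrp.{u}
  /-- The group `Ubar` on the right. -/
  Ubar : ProfiniteGrp.{u}
  /-- The underlying short exact sequence of abstract groups. -/
  ext : GroupExtension (Multiplicative (ZMod p)) U Ubar
  continuous_rightHom : Continuous ext.rightHom
  central : ext.inl.range ≤ Subgroup.center U

namespace CentralExtension

variable {p : ℕ} (ω : CentralExtension.{u} p)

/-- The projection `λ : U → Ubar`. -/
def proj : ω.U →ₜ* ω.Ubar := ⟨ω.ext.rightHom, ω.continuous_rightHom⟩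

/-- Finitely many continuous homomorphisms `γᵢ : Ubar → U` have trivial common kernel. -/
def AssumptionI : Prop :=
  ∃ (n : ℕ) (γ : Fin n → (ω.Ubar →ₜ* ω.U)), ⨅ i, (γ i : ω.Ubar →* ω.U).ker = ⊥

/-- `ℤ/p` embeds in `Ubar`. -/
def AssumptionII : Prop :=
  ∃ f : Multiplicative (ZMod p) →* ω.Ubar, Function.Injective f

/-- The projection of a central extension of profinite groups by `ℤ/p` has a continuous
set-theoretic section. -/
theorem exists_section [NeZero p] :
    ∃ s : C(ω.Ubar, ω.U), ∀ x, ω.ext.rightHom (s x) = x := by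
  classical
  set l := ω.ext.rightHom with hl
  have hc : Continuous l := ω.continuous_rightHom
  have hs : Function.Surjective l := ω.ext.rightHom_surjective
  have hfin : (l.ker : Set ω.U).Finite := by
    rw [← ω.ext.range_inl_eq_ker_rightHom, MonoidHom.coe_range]
    exact Set.finite_range _
  have hopen : IsOpen ((l.ker : Set ω.U) \ {1})ᶜ :=
    (hfin.subset Set.sdiff_subset).isClosed.isOpen_compl
  obtain ⟨V, hV⟩ := ProfiniteGrp.exist_openNormalSubgroup_sub_open_nhds_of_one hopen
    (by simp)
  have hVk : ∀ y ∈ V.toSubgroup, l y = 1 → y = 1 := by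
    intro y hy hy1
    by_contra hne
    exact hV hy ⟨hy1, hne⟩
  have hq : IsOpenQuotientMap l :=
    MonoidHom.isOpenQuotientMap_of_isQuotientMap (hc.isClosedMap.isQuotientMap hc hs)
  set W : Subgroup ω.Ubar := V.toSubgroup.map l with hW
  have hWo : IsOpen (W : Set ω.Ubar) := by
    rw [hW, Subgroup.coe_map]
    exact hq.isOpenMap _ V.isOpen'
  have : DiscreteTopology (ω.Ubar ⧸ W) := QuotientGroup.discreteTopology hWo
  choose u hu using fun c : ω.Ubar ⧸ W => hs c.out
  have hr : Continuous fun y : ω.U => u (QuotientGroup.mk (l y) : ω.Ubar ⧸ W) :=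
    (continuous_of_discreteTopology (f := u)).comp (QuotientGroup.continuous_mk.comp hc)
  let S : Set ω.U := {y | (u (QuotientGroup.mk (l y) : ω.Ubar ⧸ W))⁻¹ * y ∈ V.toSubgroup}
  have hS : IsClosed S :=
    (Subgroup.isClosed_of_isOpen _ V.isOpen').preimage (hr.inv.mul continuous_id)
  have : CompactSpace S := isCompact_iff_compactSpace.mp hS.isCompact
  have hbij : Function.Bijective fun y : S => l y.1 := by
    constructor
    · rintro ⟨y, hy⟩ ⟨z, hz⟩ hyz
      simp only at hyz
      simp only [S, Set.mem_ofPred_eq] at hy hz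
      rw [hyz] at hy
      have h1 := V.toSubgroup.mul_mem (V.toSubgroup.inv_mem hy) hz
      have h2 := hVk _ h1 (by simp [hyz])
      ext
      have h3 : y⁻¹ * z = 1 := by rw [← h2]; group
      exact inv_mul_eq_one.mp h3
    · intro x
      have h1 : (l (u (QuotientGroup.mk x : ω.Ubar ⧸ W)))⁻¹ * x ∈ W := by
        rw [hu]
        exact QuotientGroup.eq.mp (QuotientGroup.out_eq' _)
      obtain ⟨v, hv, hvx⟩ := h1
      have h2 : l (u (QuotientGroup.mk x : ω.Ubar ⧸ W) * v) = x := by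
        rw [map_mul, hvx]; group
      refine ⟨⟨u (QuotientGroup.mk x : ω.Ubar ⧸ W) * v, ?_⟩, h2⟩
      simp only [S, Set.mem_ofPred_eq]
      rw [h2]
      simpa using hv
  let e : S ≃ₜ ω.Ubar :=
    Continuous.homeoOfEquivCompactToT2 (f := Equiv.ofBijective _ hbij)
      (hc.comp continuous_subtype_val)
  refine ⟨⟨fun x => (e.symm x).1, continuous_subtype_val.comp e.symm.continuous⟩, fun x => ?_⟩
  exact e.apply_symm_apply x

/-- The value of the factor set of a section `s`: the element `z ∈ ℤ/p` with
`z = s g * s h * (s (g * h))⁻¹`. -/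
theorem exists_factorSet (s : ω.Ubar → ω.U) (hs : ∀ x, ω.ext.rightHom (s x) = x)
    (a : ω.Ubar × ω.Ubar) :
    ∃ z : ZMod p, ω.ext.inl (Multiplicative.ofAdd z) = s a.1 * s a.2 * (s (a.1 * a.2))⁻¹ := by
  have h : s a.1 * s a.2 * (s (a.1 * a.2))⁻¹ ∈ ω.ext.inl.range := by
    rw [ω.ext.range_inl_eq_ker_rightHom, MonoidHom.mem_ker]
    simp [hs]
  obtain ⟨z, hz⟩ := h
  exact ⟨z.toAdd, hz⟩

/-- The factor set `(g, h) ↦ s g * s h * (s (g * h))⁻¹ ∈ ℤ/p` of a continuous section `s`, a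
continuous `2`-cocycle of `Ubar`. -/
noncomputable def factorSet [NeZero p] (s : C(ω.Ubar, ω.U))
    (hs : ∀ x, ω.ext.rightHom (s x) = x) : cocycles₂ p ω.Ubar := by
  refine ⟨⟨fun a => (ω.exists_factorSet s hs a).choose, ?_⟩, ?_⟩
  · have hemb : Topology.IsClosedEmbedding
        (fun z : ZMod p => ω.ext.inl (Multiplicative.ofAdd z)) :=
      Continuous.isClosedEmbedding continuous_of_discreteTopology
        (ω.ext.inl_injective.comp Multiplicative.ofAdd.injective)
    rw [hemb.isEmbedding.continuous_iff]
    have : ((fun z : ZMod p => ω.ext.inl (Multiplicative.ofAdd z)) ∘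
        fun a => (ω.exists_factorSet s hs a).choose) =
        fun a : ω.Ubar × ω.Ubar => s a.1 * s a.2 * (s (a.1 * a.2))⁻¹ := by
      funext a
      exact (ω.exists_factorSet s hs a).choose_spec
    rw [this]
    fun_prop
  · intro g h j
    apply Multiplicative.ofAdd.injective
    apply ω.ext.inl_injective
    have hcen : ∀ (z : ZMod p) (y : ω.U),
        y * ω.ext.inl (Multiplicative.ofAdd z) = ω.ext.inl (Multiplicative.ofAdd z) * y :=
      fun z y => Subgroup.mem_center_iff.mp (ω.central ⟨_, rfl⟩) y
    have e := fun a => (ω.exists_factorSet s hs a).choose_spec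
    simp only [ContinuousMap.coe_mk, ofAdd_add, map_mul]
    have h1 := hcen (ω.exists_factorSet s hs (h, j)).choose (s g)
    rw [e (g, h * j), ← mul_assoc, ← mul_assoc, ← h1, e (h, j), e (g * h, j), ]
    have h2 := hcen (ω.exists_factorSet s hs (g, h)).choose
      (s (g * h) * s j * (s (g * h * j))⁻¹)
    simp only [h2]
    rw [e (g, h)]
    simp only [mul_assoc]
    simp

@[simp]
theorem inl_factorSet [NeZero p] (s : C(ω.Ubar, ω.U))
    (hs : ∀ x, ω.ext.rightHom (s x) = x) (g h : ω.Ubar) :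
    ω.ext.inl (Multiplicative.ofAdd ((ω.factorSet s hs).1 (g, h))) =
      s g * s h * (s (g * h))⁻¹ :=
  (ω.exists_factorSet s hs (g, h)).choose_spec

/-- The class `α_ω ∈ H²(Ubar)` of the extension `ω` under the Schreier correspondence: the class
of the factor set of a continuous section of `U → Ubar`. -/
noncomputable def classifyingElement [NeZero p] : H2 p ω.Ubar :=
  QuotientAddGroup.mk (ω.factorSet ω.exists_section.choose ω.exists_section.choose_spec)

/-- The classifying element may be computed from any continuous section. -/
theorem classifyingElement_eq [NeZero p] (s : C(ω.Ubar, ω.U))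
    (hs : ∀ x, ω.ext.rightHom (s x) = x) :
    ω.classifyingElement = QuotientAddGroup.mk (ω.factorSet s hs) := by
  have h2 : ∀ y, ω.ext.rightHom (ω.exists_section.choose y) = y :=
    ω.exists_section.choose_spec
  change QuotientAddGroup.mk (ω.factorSet ω.exists_section.choose h2) = _
  generalize ω.exists_section.choose = t at h2 ⊢
  rw [QuotientAddGroup.eq]
  have hx : ∀ g, ∃ z : ZMod p, ω.ext.inl (Multiplicative.ofAdd z) = s g * (t g)⁻¹ := by
    intro g
    have h : s g * (t g)⁻¹ ∈ ω.ext.inl.range := by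
      rw [ω.ext.range_inl_eq_ker_rightHom, MonoidHom.mem_ker]
      simp [hs, h2]
    obtain ⟨z, hz⟩ := h
    exact ⟨z.toAdd, hz⟩
  choose x hx using hx
  have hemb : Topology.IsClosedEmbedding
      (fun z : ZMod p => ω.ext.inl (Multiplicative.ofAdd z)) :=
    Continuous.isClosedEmbedding continuous_of_discreteTopology
      (ω.ext.inl_injective.comp Multiplicative.ofAdd.injective)
  have hxc : Continuous x := by
    rw [hemb.isEmbedding.continuous_iff]
    have : ((fun z : ZMod p => ω.ext.inl (Multiplicative.ofAdd z)) ∘ x) =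
        fun g => s g * (t g)⁻¹ := funext hx
    rw [this]
    fun_prop
  have hcen : ∀ (z : ZMod p) (y : ω.U),
      y * ω.ext.inl (Multiplicative.ofAdd z) = ω.ext.inl (Multiplicative.ofAdd z) * y :=
    fun z y => Subgroup.mem_center_iff.mp (ω.central ⟨_, rfl⟩) y
  refine ⟨⟨x, hxc⟩, ?_⟩
  ext ⟨g, h⟩
  have key : (ω.factorSet s hs).1 (g, h) + x (g * h) =
      (ω.factorSet t h2).1 (g, h) + (x g + x h) := by
    apply Multiplicative.ofAdd.injective
    apply ω.ext.inl_injective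
    rw [ofAdd_add, ofAdd_add, ofAdd_add, map_mul, map_mul, map_mul, inl_factorSet,
      inl_factorSet]
    have e : ∀ g, s g = ω.ext.inl (Multiplicative.ofAdd (x g)) * t g := fun g => by
      rw [hx]; group
    rw [e g, e h, e (g * h)]
    have hg := hcen (x g) (t g * t h * (t (g * h))⁻¹)
    have hh := hcen (x h) (t g * t h * (t (g * h))⁻¹)
    have hh' := hcen (x h) (t g)
    generalize ω.ext.inl (Multiplicative.ofAdd (x g)) = a at *
    generalize ω.ext.inl (Multiplicative.ofAdd (x h)) = b at *
    generalize ω.ext.inl (Multiplicative.ofAdd (x (g * h))) = c at *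
    calc a * t g * (b * t h) * (c * t (g * h))⁻¹ * c
        = a * (t g * b) * t h * (t (g * h))⁻¹ := by group
      _ = a * (b * (t g * t h * (t (g * h))⁻¹)) := by rw [hh']; group
      _ = a * (t g * t h * (t (g * h))⁻¹) * b := by rw [← hh]; group
      _ = t g * t h * (t (g * h))⁻¹ * (a * b) := by rw [← hg]; group
  simp only [d₁, AddMonoidHom.coe_mk, ZeroHom.coe_mk, ContinuousMap.coe_mk, AddSubgroup.coe_add,
    AddSubgroup.coe_neg, ContinuousMap.add_apply, ContinuousMap.neg_apply]
  linear_combination -key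

end CentralExtension

/-! ### The subgroups `T(G)` and `Tbar(G)` -/

section Intersections

variable (U : Type*) [Group U] [TopologicalSpace U]
  (G : Type*) [Group G] [TopologicalSpace G]

/-- `T^U(G)`: the intersection of the kernels of all continuous homomorphisms `G → U`. -/
def kernelIntersection : Subgroup G := ⨅ ρ : G →ₜ* U, (ρ : G →* U).ker

instance : (kernelIntersection U G).Normal :=
  Subgroup.normal_iInf_normal fun _ => inferInstance

variable {p : ℕ} (Ω : Set (CentralExtension.{u} p))

/-- `T(G) = ⋂_{ω ∈ Ω} T^{U_ω}(G)`. -/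
def T : Subgroup G := ⨅ ω ∈ Ω, kernelIntersection ω.U G

/-- `Tbar(G) = ⋂_{ω ∈ Ω} T^{Ubar_ω}(G)`. -/
def Tbar : Subgroup G := ⨅ ω ∈ Ω, kernelIntersection ω.Ubar G

instance : (T G Ω).Normal :=
  Subgroup.normal_iInf_normal fun _ => Subgroup.normal_iInf_normal fun _ => inferInstance

instance : (Tbar G Ω).Normal :=
  Subgroup.normal_iInf_normal fun _ => Subgroup.normal_iInf_normal fun _ => inferInstance

end Intersections

/-! ### Liftable pullbacks and the kernel generating condition -/

section Liftable

variable {p : ℕ} {G : Type v} [Group G] [TopologicalSpace G] [IsTopologicalGroup G]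

/-- A continuous homomorphism `G ⧸ N → Ubar` is liftable (along `G → G ⧸ N`) if its composition
with `G → G ⧸ N` factors as `G → U → Ubar` for some continuous homomorphism `G → U`. -/
def IsLiftable (ω : CentralExtension.{u} p) {N : Subgroup G} [N.Normal]
    (ρbar : G ⧸ N →ₜ* ω.Ubar) : Prop :=
  ∃ ρ : G →ₜ* ω.U, ∀ g : G, ω.proj (ρ g) = ρbar (QuotientGroup.mk g)

variable (Ω : Set (CentralExtension.{u} p))

/-- The set of liftable pullbacks `ρbar^*(α_ω) ∈ H²(G ⧸ N)`, `ω ∈ Ω`. -/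
def liftablePullbacks [NeZero p] (N : Subgroup G) [N.Normal] : Set (H2 p (G ⧸ N)) :=
  {c | ∃ ω ∈ Ω, ∃ ρbar : G ⧸ N →ₜ* ω.Ubar, IsLiftable ω ρbar ∧
    c = H2Map ρbar ω.classifyingElement}

/-- The liftable part of `H²(G ⧸ N)`: the subgroup generated by the liftable pullbacks. -/
def liftablePart [NeZero p] (N : Subgroup G) [N.Normal] : AddSubgroup (H2 p (G ⧸ N)) :=
  AddSubgroup.closure (liftablePullbacks Ω N)

/-- The natural projection `G ⧸ N₁ → G ⧸ N₂` for `N₁ ≤ N₂`. -/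
def quotientProj {N₁ N₂ : Subgroup G} [N₁.Normal] [N₂.Normal] (h : N₁ ≤ N₂) :
    G ⧸ N₁ →ₜ* G ⧸ N₂ where
  toMonoidHom := QuotientGroup.map N₁ N₂ (MonoidHom.id G) h
  continuous_toFun :=
    (QuotientGroup.isQuotientMap_mk N₁).continuous_iff.mpr QuotientGroup.continuous_mk

variable (p) in
/-- The inflation map `H²(G ⧸ N₂) → H²(G ⧸ N₁)` for `N₁ ≤ N₂`. -/
def inflation {N₁ N₂ : Subgroup G} [N₁.Normal] [N₂.Normal] (h : N₁ ≤ N₂) :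
    H2 p (G ⧸ N₂) →+ H2 p (G ⧸ N₁) :=
  H2Map (quotientProj h)

/-- `B_G(N₁, N₂)`: the subgroup of `H²(G ⧸ N₂)` generated by the liftable pullbacks whose
inflation to `G ⧸ N₁` vanishes. -/
def B [NeZero p] {N₁ N₂ : Subgroup G} [N₁.Normal] [N₂.Normal] (h : N₁ ≤ N₂) :
    AddSubgroup (H2 p (G ⧸ N₂)) :=
  AddSubgroup.closure {c | c ∈ liftablePullbacks Ω N₂ ∧ c ∈ (inflation p h).ker}

/-- `C_G(N₁, N₂)`: the kernel of the inflation map on the liftable part of `H²(G ⧸ N₂)`. -/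
def C [NeZero p] {N₁ N₂ : Subgroup G} [N₁.Normal] [N₂.Normal] (h : N₁ ≤ N₂) :
    AddSubgroup (H2 p (G ⧸ N₂)) :=
  ((inflation p h).comp (liftablePart Ω N₂).subtype).ker.map (liftablePart Ω N₂).subtype

/-- The kernel generating condition for `N₁ ≤ N₂`. -/
def KernelGeneratingCondition [NeZero p] {N₁ N₂ : Subgroup G} [N₁.Normal] [N₂.Normal]
    (h : N₁ ≤ N₂) : Prop :=
  B Ω h = C Ω h

end Liftable

end KernelGenerating

/-! Put `S = Tbar G Ω`. A continuous `ρ : G → U_ω` becomes trivial on `S` after projection to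
`Ubar_ω`, so it restricts to a character `S → ℤ/p`. Let `A` be the set of these characters and `L`
the group of functions on `S` vanishing on `N`. The transgression of such a character is, up to
sign, the liftable pullback attached to `ρ`. By (II) every continuous character of `G` vanishes on
`S`, so transgression is injective, and the pullback dies in `H²(G ⧸ N)` exactly when the character
dies on `N` (`inflation_toH2_eq_zero_iff`, `ker_toH2`). Hence (c) amounts to `⟨A ∩ L⟩ = ⟨A⟩ ∩ L`.

Duality on the compact group `S` (`closure_inter_annihilator_eq_iff`) turns this into an equality of
annihilators: that of `A ∩ L` is `N` times that of `A`. By (I), `T(G) ≤ S`, so `T(G)` is the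
annihilator of `A`; the preimage of `T(G ⧸ N)` is the annihilator of `A ∩ L`. The equality therefore
says `π[T(G)] = T(G ⧸ N)` (`map_T_eq_iff`).

Instead of a transgression map, a group of cochain–cocycle pairs is used, mapping both to `H²(G ⧸
S)` and to characters of `S`. The two maps have the same kernel, which suffices to transfer the
generation statement (`closure_image_inter_eq_iff`). -/

namespace KernelGenerating

/-! ### Duality between families of characters and closed subgroups -/

section Duality

variable {p : ℕ} [Fact p.Prime] {S : Type*} [Group S]

/-- A vector outside the image of a subgroup under finitely many characters is separated from
this image by a linear combination of the coordinates. -/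
theorem exists_separating_combination {ι : Type*} [Fintype ι] (f : ι → S → ZMod p)
    (hf : ∀ i a b, f i (a * b) = f i a + f i b) (K : Subgroup S) (e : ι → ZMod p)
    (he : ∀ n ∈ K, ∃ i, f i n ≠ e i) :
    ∃ a : ι → ZMod p, (∀ n ∈ K, ∑ i, a i * f i n = 0) ∧ ∑ i, a i * e i ≠ 0 := by
  classical
  let F : S →* Multiplicative (ι → ZMod p) :=
    { toFun := fun s => Multiplicative.ofAdd fun i => f i s
      map_one' := by
        apply Multiplicative.toAdd.injective
        funext i
        simpa using hf i 1 1
      map_mul' := fun a b => by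
        apply Multiplicative.toAdd.injective
        funext i
        simpa using hf i a b }
  -- Over the prime field an additive subgroup is already a subspace, so a linear functional
  -- separates `e` from it.
  let W : Submodule (ZMod p) (ι → ZMod p) :=
    AddSubgroup.toZModSubmodule p (Subgroup.toAddSubgroup' (K.map F))
  have hW : ∀ x, x ∈ W ↔ ∃ n ∈ K, (fun i => f i n) = x := fun x => Iff.rfl
  have heW : e ∉ W := by
    rw [hW]
    rintro ⟨n, hn, h⟩
    obtain ⟨i, hi⟩ := he n hn
    exact hi (congrFun h i)
  obtain ⟨φ, hφe, hφ⟩ := Submodule.exists_le_ker_of_notMem heW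
  have hsum : ∀ x : ι → ZMod p, φ x = ∑ i, φ (fun j => if i = j then 1 else 0) * x i := by
    intro x
    rw [LinearMap.pi_apply_eq_sum_univ φ x]
    simp [mul_comm]
  refine ⟨fun i => φ (fun j => if i = j then 1 else 0), fun n hn => ?_, ?_⟩
  · rw [← hsum fun i => f i n]
    exact hφ ((hW _).mpr ⟨n, hn, rfl⟩)
  · rwa [← hsum]

theorem sum_mul_mem {S ι : Type*} (M : AddSubgroup (S → ZMod p)) [Fintype ι]
    (a : ι → ZMod p) (f : ι → S → ZMod p) (hf : ∀ i, f i ∈ M) :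
    (fun s => ∑ i, a i * f i s) ∈ M := by
  have h : (∑ i, a i • f i) ∈ AddSubgroup.toZModSubmodule p M :=
    Submodule.sum_mem _ fun i _ => Submodule.smul_mem _ _ (hf i)
  have he : (fun s => ∑ i, a i * f i s) = ∑ i, a i • f i := by
    funext s
    simp
  rw [he]
  exact h

variable [TopologicalSpace S] [CompactSpace S] (M : AddSubgroup (S → ZMod p))

/-- A continuous character vanishing on the annihilator of a group `M` of continuous characters
of a compact group lies in `M`. -/
theorem mem_of_forall_annihilator
    (hM : ∀ χ ∈ M, Continuous χ ∧ ∀ a b, χ (a * b) = χ a + χ b)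
    (χ : S → ZMod p) (hc : Continuous χ) (hχ : ∀ a b, χ (a * b) = χ a + χ b)
    (h : ∀ s, (∀ m ∈ M, m s = 0) → χ s = 0) : χ ∈ M := by
  classical
  have hcl : ∀ m : M, IsClosed {s | m.1 s = 0} := fun m =>
    isClosed_singleton.preimage (hM m.1 m.2).1
  have hopen : IsOpen {s | χ s = 0} := (isOpen_discrete {0}).preimage hc
  obtain ⟨t, ht⟩ := hopen.isClosed_compl.isCompact.elim_finite_subfamily_closed _ hcl (by
    ext s
    simp only [Set.mem_inter_iff, Set.mem_iInter, Set.mem_empty_iff_false, iff_false, not_and]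
    intro hs hm
    exact hs (h s fun m hmM => hm ⟨m, hmM⟩))
  let f : Option t → S → ZMod p := fun o => o.elim χ fun m => m.1.1
  -- The value vector with `χ = 1` and all `m = 0` is not attained on `S`. A relation separating it
  -- has nonzero coefficient at `χ` and can be solved for `χ`.
  let e : Option t → ZMod p := fun o => o.elim 1 fun _ => 0
  obtain ⟨a, ha, hae⟩ := exists_separating_combination f (by
    rintro (_ | m)
    · exact hχ
    · exact (hM m.1.1 m.1.2).2) ⊤ e (by
    intro n _
    by_contra! hn
    have hχn : χ n = 1 := hn none
    have : n ∈ ({s | χ s = 0}ᶜ ∩ ⋂ m ∈ t, {s | m.1 s = 0} : Set S) := by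
      refine ⟨?_, ?_⟩
      · simp [hχn]
      · simp only [Set.mem_iInter]
        intro m hm
        exact hn (some ⟨m, hm⟩)
    rw [ht] at this
    exact this)
  rw [Fintype.sum_option] at hae
  simp only [Fintype.sum_option] at ha
  simp only [e, Option.elim, mul_one, mul_zero, Finset.sum_const_zero, add_zero] at hae
  have hmem := sum_mul_mem M (fun m : t => -(a none)⁻¹ * a (some m)) (fun m : t => m.1.1)
    fun m => m.1.2
  refine (congrArg (· ∈ M) (funext fun s => ?_)).mpr hmem
  have hs := ha s trivial
  simp only [f, Option.elim] at hs
  simp only [mul_assoc, ← Finset.mul_sum]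
  field_simp
  linear_combination hs

/-- If every character in `M` that vanishes on the closed subgroup `K` vanishes at `s`, then `s`
lies in the product of `K` and the annihilator of `M`. -/
theorem exists_mem_forall_eq
    (hM : ∀ χ ∈ M, Continuous χ ∧ ∀ a b, χ (a * b) = χ a + χ b)
    (K : Subgroup S) (hK : IsClosed (K : Set S)) (s : S)
    (h : ∀ m ∈ M, (∀ n ∈ K, m n = 0) → m s = 0) : ∃ n ∈ K, ∀ m ∈ M, m n = m s := by
  classical
  by_contra! hcon
  have hcl : ∀ m : M, IsClosed {n | m.1 n = m.1 s} := fun m =>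
    isClosed_singleton.preimage (hM m.1 m.2).1
  obtain ⟨t, ht⟩ := hK.isCompact.elim_finite_subfamily_closed _ hcl (by
    ext n
    simp only [Set.mem_inter_iff, Set.mem_iInter, Set.mem_empty_iff_false, iff_false, not_and]
    intro hn hm
    obtain ⟨m, hmM, hne⟩ := hcon n hn
    exact hne (hm ⟨m, hmM⟩))
  obtain ⟨a, ha, hae⟩ := exists_separating_combination (fun (m : t) => m.1.1)
    (fun m => (hM m.1.1 m.1.2).2) K (fun m => m.1.1 s) (by
      intro n hn
      by_contra! hm
      have : n ∈ ((K : Set S) ∩ ⋂ m ∈ t, {n | m.1 n = m.1 s} : Set S) := by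
        refine ⟨hn, ?_⟩
        simp only [Set.mem_iInter]
        exact fun m hmt => hm ⟨m, hmt⟩
      rw [ht] at this
      exact this)
  -- The separating combination lies in `M` and vanishes on `K`, but not at `s`.
  exact hae (h _ (sum_mul_mem M a (fun m : t => m.1.1) fun m => m.1.2) ha)

/-- The characters of a set `A` that vanish on a closed subgroup `K` generate all characters in
`⟨A⟩` that vanish on `K` if and only if their annihilator is the product of `K` and the annihilator
of `A`. -/
theorem closure_inter_annihilator_eq_iff (A : Set (S → ZMod p))
    (hA : ∀ χ ∈ A, Continuous χ ∧ ∀ a b, χ (a * b) = χ a + χ b)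
    (K : Subgroup S) (hK : IsClosed (K : Set S))
    (L : AddSubgroup (S → ZMod p)) (hL : ∀ χ, χ ∈ L ↔ ∀ n ∈ K, χ n = 0) :
    AddSubgroup.closure (A ∩ L) = AddSubgroup.closure A ⊓ L ↔
      ∀ s, (∀ χ ∈ A, χ ∈ L → χ s = 0) → ∃ n ∈ K, ∀ χ ∈ A, χ n = χ s := by
  have hcl : ∀ χ ∈ AddSubgroup.closure A, Continuous χ ∧ ∀ a b, χ (a * b) = χ a + χ b := by
    intro χ hχ
    induction hχ using AddSubgroup.closure_induction with
    | mem χ h => exact hA χ h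
    | zero => exact ⟨continuous_const, by simp⟩
    | add x y _ _ hx hy =>
      refine ⟨hx.1.add hy.1, fun a b => ?_⟩
      simp only [Pi.add_apply, hx.2, hy.2]
      ring
    | neg x _ hx =>
      refine ⟨hx.1.neg, fun a b => ?_⟩
      simp only [Pi.neg_apply, hx.2]
      ring
  have hle : AddSubgroup.closure (A ∩ L) ≤ AddSubgroup.closure A ⊓ L :=
    le_inf (AddSubgroup.closure_mono Set.inter_subset_left)
      ((AddSubgroup.closure_le _).mpr Set.inter_subset_right)
  have hext : ∀ (X : Set (S → ZMod p)) (φ : (S → ZMod p) →+ ZMod p), (∀ χ ∈ X, φ χ = 0) →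
      ∀ χ ∈ AddSubgroup.closure X, φ χ = 0 := fun X φ h χ hχ =>
    (AddSubgroup.closure_le φ.ker).mpr h hχ
  constructor
  · intro h s hs
    obtain ⟨n, hn, hns⟩ := exists_mem_forall_eq _ hcl K hK s (fun m hm hmK => by
      have hm' : m ∈ AddSubgroup.closure (A ∩ L) := by
        rw [h]
        exact ⟨hm, (hL m).mpr hmK⟩
      exact hext (A ∩ L) (Pi.evalAddMonoidHom _ s) (fun χ hχ => hs χ hχ.1 hχ.2) m hm')
    exact ⟨n, hn, fun χ hχ => hns χ (AddSubgroup.subset_closure hχ)⟩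
  · intro h
    refine le_antisymm hle ?_
    rintro χ ⟨hχ, hχL⟩
    refine mem_of_forall_annihilator _ (fun m hm => hcl m (hle hm).1) χ (hcl χ hχ).1
      (hcl χ hχ).2 fun s hs => ?_
    obtain ⟨n, hn, hns⟩ := h s fun m hmA hmL => hs m (AddSubgroup.subset_closure ⟨hmA, hmL⟩)
    have := hext A (Pi.evalAddMonoidHom (fun _ : S => ZMod p) n - Pi.evalAddMonoidHom _ s)
      (fun m hm => sub_eq_zero.mpr (hns m hm)) χ hχ
    have h0 : χ n = 0 := (hL χ).mp hχL n hn
    simpa [h0] using this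

end Duality

/-! ### Transfer of generation statements between two images of one group -/

/-- Both sides are images under `i`, because `i(Q) ∩ L = i(Q ∩ i⁻¹(L))` and likewise for `⟨Q⟩`; two
subgroups have the same image exactly when they agree after adding the kernel. -/
theorem closure_image_inter_eq_iff_sup_ker {P H : Type*} [AddGroup P] [AddGroup H]
    (i : P →+ H) (Q : Set P) (L : AddSubgroup H) :
    AddSubgroup.closure (i '' Q ∩ L) = AddSubgroup.closure (i '' Q) ⊓ L ↔
      AddSubgroup.closure (Q ∩ L.comap i) ⊔ i.ker =
        (AddSubgroup.closure Q ⊓ L.comap i) ⊔ i.ker := by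
  have h1 : AddSubgroup.closure (i '' Q ∩ L) =
      (AddSubgroup.closure (Q ∩ L.comap i)).map i := by
    rw [AddMonoidHom.map_closure, AddSubgroup.coe_comap, Set.image_inter_preimage]
  have h2 : AddSubgroup.closure (i '' Q) ⊓ L = (AddSubgroup.closure Q ⊓ L.comap i).map i := by
    rw [← AddMonoidHom.map_closure]
    apply SetLike.coe_injective
    simp [Set.image_inter_preimage]
  rw [h1, h2, AddSubgroup.map_eq_map_iff]

/-- Whether `⟨i(Q) ∩ L⟩ = ⟨i(Q)⟩ ∩ L` depends only on the kernel of `i` and the preimage of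
`L`. -/
theorem closure_image_inter_eq_iff {P H F : Type*} [AddGroup P] [AddGroup H]
    [AddGroup F] (i : P →+ H) (j : P →+ F) (hij : i.ker = j.ker) (Q : Set P)
    (L : AddSubgroup H) (L' : AddSubgroup F) (hL : L.comap i = L'.comap j) :
    AddSubgroup.closure (i '' Q ∩ L) = AddSubgroup.closure (i '' Q) ⊓ L ↔
      AddSubgroup.closure (j '' Q ∩ L') = AddSubgroup.closure (j '' Q) ⊓ L' := by
  rw [closure_image_inter_eq_iff_sup_ker, closure_image_inter_eq_iff_sup_ker, hij, hL]

/-! ### Transgression, expressed through trivialized inflations -/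

section Transgression

variable {p : ℕ} {G : Type v} [Group G] [TopologicalSpace G] [IsTopologicalGroup G]

theorem mk_eq_zero_iff {K : Type*} [Group K] [TopologicalSpace K] [IsTopologicalGroup K]
    (f : cocycles₂ p K) :
    (QuotientAddGroup.mk f : H2 p K) = 0 ↔
      ∃ w : C(K, ZMod p), ∀ a b, f.1 (a, b) = w b - w (a * b) + w a := by
  rw [QuotientAddGroup.eq_zero_iff]
  constructor
  · rintro ⟨w, rfl⟩
    exact ⟨w, fun a b => rfl⟩
  · rintro ⟨w, hw⟩
    refine ⟨w, ?_⟩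
    ext ⟨a, b⟩
    exact (hw a b).symm

variable (p) in
/-- Pairs of a continuous cochain `u` on `G` and a cocycle `f` on `G ⧸ S` such that the inflation
of `f` to `G` is the coboundary of `-u`. -/
def inflationTrivializations (S : Subgroup G) [S.Normal] :
    AddSubgroup (C(G, ZMod p) × cocycles₂ p (G ⧸ S)) where
  carrier := {x | ∀ g h : G, x.2.1 (QuotientGroup.mk g, QuotientGroup.mk h) =
    x.1 (g * h) - x.1 g - x.1 h}
  zero_mem' := by intro g h; simp
  add_mem' := by
    intro a b ha hb g h
    have h1 := ha g h
    have h2 := hb g h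
    simp only [Prod.snd_add, Prod.fst_add, AddSubgroup.coe_add, ContinuousMap.add_apply]
    linear_combination h1 + h2
  neg_mem' := by
    intro a ha g h
    have h1 := ha g h
    simp only [Prod.snd_neg, Prod.fst_neg, AddSubgroup.coe_neg, ContinuousMap.neg_apply]
    linear_combination -h1

namespace inflationTrivializations

variable {S : Subgroup G} [S.Normal]

/-- The cohomology class in `H²(G ⧸ S)` of the cocycle. -/
def toH2 : inflationTrivializations p S →+ H2 p (G ⧸ S) :=
  (QuotientAddGroup.mk' _).comp ((AddMonoidHom.snd _ _).comp (AddSubgroup.subtype _))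

/-- The character of `S` obtained by restricting the normalized cochain; its transgression is, up to
sign, the class of the cocycle. -/
def restrict : inflationTrivializations p S →+ (S → ZMod p) where
  toFun x s := x.1.1 s - x.1.1 1
  map_zero' := by funext s; simp
  map_add' x y := by
    funext s
    simp only [AddSubgroup.coe_add, Prod.fst_add, ContinuousMap.add_apply, Pi.add_apply]
    ring

/-- The pairs `(g, s)` and `(g, 1)` have the same image in `G ⧸ S`, so the cocycle takes the same
value on them; the difference of the two coboundary identities is the claim. -/
theorem apply_mul (x : inflationTrivializations p S) (g : G) (s : S) :
    x.1.1 (g * s) = x.1.1 g + restrict x s := by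
  have h1 := x.2 g s
  have h4 := x.2 g 1
  have hs : (QuotientGroup.mk (s : G) : G ⧸ S) = 1 := (QuotientGroup.eq_one_iff _).mpr s.2
  rw [hs] at h1
  simp only [QuotientGroup.mk_one, mul_one] at h1 h4
  simp only [restrict, AddMonoidHom.coe_mk, ZeroHom.coe_mk]
  linear_combination h4 - h1

theorem restrict_mul (x : inflationTrivializations p S) (s t : S) :
    restrict x (s * t) = restrict x s + restrict x t := by
  have h := apply_mul x s t
  simp only [restrict, AddMonoidHom.coe_mk, ZeroHom.coe_mk, Subgroup.coe_mul] at h ⊢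
  linear_combination h

theorem continuous_restrict (x : inflationTrivializations p S) : Continuous (restrict x) := by
  simp only [restrict, AddMonoidHom.coe_mk, ZeroHom.coe_mk]
  fun_prop

/-- If all characters of `G` vanish on `S`, then the inflation of the class to `G ⧸ N` vanishes
if and only if the character of `S` vanishes on `N`. -/
theorem inflation_toH2_eq_zero_iff
    (hS : ∀ χ : C(G, ZMod p), (∀ a b, χ (a * b) = χ a + χ b) → ∀ s ∈ S, χ s = 0)
    {N : Subgroup G} [N.Normal] (hNS : N ≤ S) (x : inflationTrivializations p S) :
    inflation p hNS (toH2 x) = 0 ↔ ∀ n ∈ N.subgroupOf S, restrict x n = 0 := by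
  have hinf : inflation p hNS (toH2 x) =
      (QuotientAddGroup.mk (cocycles₂Map (quotientProj hNS) x.1.2) : H2 p (G ⧸ N)) := rfl
  have hval : ∀ g h : G, (cocycles₂Map (quotientProj hNS) x.1.2).1
      (QuotientGroup.mk g, QuotientGroup.mk h) = x.1.1 (g * h) - x.1.1 g - x.1.1 h :=
    fun g h => x.2 g h
  rw [hinf, mk_eq_zero_iff]
  constructor
  · rintro ⟨w, hw⟩ n hn
    -- If `w` trivializes the inflated cocycle on `G ⧸ N`, then `u + w` is a character of `G`, hence
    -- zero on `S`. As `w` is constant on `N`, so is `u`.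
    have hχ := hS (x.1.1 + w.comp ⟨QuotientGroup.mk, QuotientGroup.continuous_mk⟩) (by
      intro a b
      have h1 := hval a b
      rw [hw] at h1
      simp only [ContinuousMap.add_apply, ContinuousMap.comp_apply, ContinuousMap.coe_mk,
        QuotientGroup.mk_mul]
      linear_combination -h1)
    have h1 := hχ n n.2
    have h2 := hχ 1 S.one_mem
    have hn1 : (QuotientGroup.mk (n : G) : G ⧸ N) = 1 :=
      (QuotientGroup.eq_one_iff _).mpr (Subgroup.mem_subgroupOf.mp hn)
    simp only [ContinuousMap.add_apply, ContinuousMap.comp_apply, ContinuousMap.coe_mk, hn1,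
      QuotientGroup.mk_one] at h1 h2
    simp only [restrict, AddMonoidHom.coe_mk, ZeroHom.coe_mk]
    linear_combination h1 - h2
  · intro h
    -- A character trivial on `N` makes `u` constant on cosets of `N`; its descent, negated, is the
    -- required cochain.
    have hinv : ∀ a b : G, QuotientGroup.leftRel N a b → x.1.1 a = x.1.1 b := by
      intro a b hab
      rw [QuotientGroup.leftRel_apply] at hab
      have h1 := apply_mul x a ⟨a⁻¹ * b, hNS hab⟩
      rw [h _ (Subgroup.mem_subgroupOf.mpr hab)] at h1
      simpa using h1.symm
    let w : C(G ⧸ N, ZMod p) := ⟨Quotient.lift x.1.1 hinv, x.1.1.continuous.quotient_lift hinv⟩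
    have hw : ∀ g : G, w (QuotientGroup.mk g) = x.1.1 g := fun g => rfl
    refine ⟨-w, fun a b => ?_⟩
    induction a using QuotientGroup.induction_on with | H a => ?_
    induction b using QuotientGroup.induction_on with | H b => ?_
    rw [hval, ← QuotientGroup.mk_mul]
    simp only [ContinuousMap.neg_apply, hw]
    ring

/-- This is the case `N = S` of the inflation criterion, where inflation is the identity. It plays
the role of injectivity of transgression. -/
theorem ker_toH2
    (hS : ∀ χ : C(G, ZMod p), (∀ a b, χ (a * b) = χ a + χ b) → ∀ s ∈ S, χ s = 0) :
    (toH2 (p := p) (S := S)).ker = restrict.ker := by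
  ext x
  have h := inflation_toH2_eq_zero_iff hS le_rfl x
  have hid : ∀ c : H2 p (G ⧸ S), inflation p (le_refl S) c = c := by
    intro c
    induction c using QuotientAddGroup.induction_on with | H f => ?_
    refine congrArg QuotientAddGroup.mk (Subtype.ext (ContinuousMap.ext fun a => ?_))
    obtain ⟨a, b⟩ := a
    induction a using QuotientGroup.induction_on with | H a => ?_
    induction b using QuotientGroup.induction_on with | H b => ?_
    rfl
  rw [hid] at h
  rw [AddMonoidHom.mem_ker, AddMonoidHom.mem_ker, h, funext_iff]
  simp

end inflationTrivializations

end Transgression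

/-! ### Restricted characters and the groups `T(G)`, `T(G ⧸ N)` -/

section Lifts

variable {p : ℕ} {G : Type v} [Group G] [TopologicalSpace G] (Ω : Set (CentralExtension.{u} p))

theorem mem_T_iff {g : G} : g ∈ T G Ω ↔ ∀ ω ∈ Ω, ∀ ρ : G →ₜ* ω.U, ρ g = 1 := by
  simp only [T, kernelIntersection, Subgroup.mem_iInf, MonoidHom.mem_ker]
  rfl

theorem mem_Tbar_iff {g : G} : g ∈ Tbar G Ω ↔ ∀ ω ∈ Ω, ∀ ρ : G →ₜ* ω.Ubar, ρ g = 1 := by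
  simp only [Tbar, kernelIntersection, Subgroup.mem_iInf, MonoidHom.mem_ker]
  rfl

theorem isClosed_Tbar : IsClosed (Tbar G Ω : Set G) := by
  have : (Tbar G Ω : Set G) = ⋂ ω ∈ Ω, ⋂ ρ : G →ₜ* ω.Ubar, {g | ρ g = 1} := by
    ext g
    simp [mem_Tbar_iff]
  rw [this]
  exact isClosed_biInter fun ω _ => isClosed_iInter fun ρ =>
    isClosed_singleton.preimage ρ.continuous_toFun

variable {Ω}

/-- Composing a map to `Ubar_ω` with the `γᵢ` gives maps to `U_ω`, which jointly detect its kernel.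
-/
theorem T_le_Tbar (hI : ∀ ω ∈ Ω, ω.AssumptionI) : T G Ω ≤ Tbar G Ω := by
  intro g hg
  rw [mem_T_iff] at hg
  rw [mem_Tbar_iff]
  intro ω hω ρ
  obtain ⟨n, γ, hγ⟩ := hI ω hω
  rw [← Subgroup.mem_bot, ← hγ, Subgroup.mem_iInf]
  exact fun i => hg ω hω ((γ i).comp ρ)

/-- Through an embedding of `ℤ/p` in `Ubar_ω`, a character of `G` becomes one of the homomorphisms
defining `Tbar`. -/
theorem character_eq_zero_of_mem_Tbar (hΩ : Ω.Nonempty) (hII : ∀ ω ∈ Ω, ω.AssumptionII)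
    (χ : C(G, ZMod p)) (hχ : ∀ a b, χ (a * b) = χ a + χ b) (s : G) (hs : s ∈ Tbar G Ω) :
    χ s = 0 := by
  obtain ⟨ω, hω⟩ := hΩ
  obtain ⟨f, hf⟩ := hII ω hω
  let ρ : G →ₜ* ω.Ubar :=
    { toMonoidHom := MonoidHom.mk' (fun g => f (Multiplicative.ofAdd (χ g))) fun a b => by
        simp [hχ]
      continuous_toFun :=
        (continuous_of_discreteTopology (f := fun z : ZMod p => f (Multiplicative.ofAdd z))).comp
          χ.continuous }
  have h1 : f (Multiplicative.ofAdd (χ s)) = f 1 := by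
    rw [map_one]
    exact (mem_Tbar_iff Ω).mp hs ω hω ρ
  exact Multiplicative.ofAdd.injective (hf h1)

theorem mk_mem_Tbar_iff [IsTopologicalGroup G] {N : Subgroup G} [N.Normal] (hN : N ≤ Tbar G Ω)
    (g : G) :
    (QuotientGroup.mk g : G ⧸ N) ∈ Tbar (G ⧸ N) Ω ↔ g ∈ Tbar G Ω := by
  simp only [mem_Tbar_iff]
  constructor
  · intro h ω hω ρ
    exact h ω hω ⟨QuotientGroup.lift N ρ.toMonoidHom fun n hn =>
      (mem_Tbar_iff Ω).mp (hN hn) ω hω ρ, ρ.continuous_toFun.quotient_lift _⟩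
  · intro h ω hω ρ
    exact h ω hω ⟨ρ.toMonoidHom.comp (QuotientGroup.mk' N),
      ρ.continuous_toFun.comp QuotientGroup.continuous_mk⟩

variable (Ω G) in
/-- The characters of `Tbar(G)` obtained by restricting continuous homomorphisms `G → U_ω`. -/
def restrictedCharacters : Set (Tbar G Ω → ZMod p) :=
  {χ | ∃ ω ∈ Ω, ∃ ρ : G →ₜ* ω.U, ∀ s, ω.ext.inl (Multiplicative.ofAdd (χ s)) = ρ s}

theorem exists_restrictedCharacter {ω : CentralExtension.{u} p} (hω : ω ∈ Ω) (ρ : G →ₜ* ω.U) :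
    ∃ χ ∈ restrictedCharacters G Ω, ∀ s, ω.ext.inl (Multiplicative.ofAdd (χ s)) = ρ s := by
  have h : ∀ s : Tbar G Ω, ∃ z : ZMod p, ω.ext.inl (Multiplicative.ofAdd z) = ρ s := by
    intro s
    have h1 : ρ s ∈ ω.ext.inl.range := by
      rw [ω.ext.range_inl_eq_ker_rightHom, MonoidHom.mem_ker]
      exact (mem_Tbar_iff Ω).mp s.2 ω hω (ω.proj.comp ρ)
    obtain ⟨z, hz⟩ := h1
    exact ⟨z.toAdd, hz⟩
  choose χ hχ using h
  exact ⟨χ, ⟨ω, hω, ρ, hχ⟩, hχ⟩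

theorem inl_eq_one_iff (ω : CentralExtension.{u} p) (z : ZMod p) :
    ω.ext.inl (Multiplicative.ofAdd z) = 1 ↔ z = 0 := by
  rw [map_eq_one_iff _ ω.ext.inl_injective, ofAdd_eq_one]

theorem mem_T_iff_restrictedCharacters (s : Tbar G Ω) :
    (s : G) ∈ T G Ω ↔ ∀ χ ∈ restrictedCharacters G Ω, χ s = 0 := by
  rw [mem_T_iff]
  constructor
  · rintro h χ ⟨ω, hω, ρ, hρ⟩
    rw [← inl_eq_one_iff ω, hρ, h ω hω]
  · intro h ω hω ρ
    obtain ⟨χ, hχ, hρ⟩ := exists_restrictedCharacter hω ρ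
    rw [← hρ, inl_eq_one_iff, h χ hχ]

/-- Homomorphisms `G ⧸ N → U_ω` are those on `G` that kill `N`; since `N ≤ Tbar G Ω`, this is a
condition on the restricted character alone. -/
theorem mk_mem_T_iff_restrictedCharacters [IsTopologicalGroup G] {N : Subgroup G} [N.Normal]
    (hN : N ≤ Tbar G Ω) (s : Tbar G Ω) :
    (QuotientGroup.mk (s : G) : G ⧸ N) ∈ T (G ⧸ N) Ω ↔
      ∀ χ ∈ restrictedCharacters G Ω, (∀ n ∈ N.subgroupOf (Tbar G Ω), χ n = 0) → χ s = 0 := by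
  rw [mem_T_iff]
  constructor
  · rintro h χ ⟨ω, hω, ρ, hρ⟩ hχN
    rw [← inl_eq_one_iff ω, hρ]
    exact h ω hω ⟨QuotientGroup.lift N ρ.toMonoidHom fun n hn => by
      have h1 := hρ ⟨n, hN hn⟩
      rw [hχN _ (Subgroup.mem_subgroupOf.mpr hn), (inl_eq_one_iff ω 0).mpr rfl] at h1
      exact h1.symm, ρ.continuous_toFun.quotient_lift _⟩
  · intro h ω hω ρ
    obtain ⟨χ, hχ, hρ⟩ := exists_restrictedCharacter hω
      (⟨ρ.toMonoidHom.comp (QuotientGroup.mk' N),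
        ρ.continuous_toFun.comp QuotientGroup.continuous_mk⟩ : G →ₜ* ω.U)
    have h0 : χ s = 0 := by
      refine h χ hχ fun n hn => ?_
      rw [← inl_eq_one_iff ω, hρ]
      have hn1 : (QuotientGroup.mk (n : G) : G ⧸ N) = 1 :=
        (QuotientGroup.eq_one_iff _).mpr (Subgroup.mem_subgroupOf.mp hn)
      change ρ (QuotientGroup.mk (n : G)) = 1
      rw [hn1, map_one]
    have h1 := hρ s
    rw [h0, (inl_eq_one_iff ω 0).mpr rfl] at h1
    exact h1.symm

variable (Ω) in
/-- `T(G ⧸ N)` is the image of `T(G)` if and only if the annihilator of the restricted characters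
vanishing on `N` is the product of `N` and the annihilator of all restricted characters. -/
theorem map_T_eq_iff [IsTopologicalGroup G] (hI : ∀ ω ∈ Ω, ω.AssumptionI) {N : Subgroup G}
    [N.Normal] (hN : N ≤ Tbar G Ω) :
    (T G Ω).map (QuotientGroup.mk' N) = T (G ⧸ N) Ω ↔
      ∀ s : Tbar G Ω,
        (∀ χ ∈ restrictedCharacters G Ω, (∀ n ∈ N.subgroupOf (Tbar G Ω), χ n = 0) → χ s = 0) →
        ∃ n ∈ N.subgroupOf (Tbar G Ω), ∀ χ ∈ restrictedCharacters G Ω, χ n = χ s := by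
  have hmul : ∀ χ ∈ restrictedCharacters G Ω, ∀ a b, χ (a * b) = χ a + χ b := by
    rintro χ ⟨ω, hω, ρ, hρ⟩ a b
    apply Multiplicative.ofAdd.injective
    apply ω.ext.inl_injective
    rw [ofAdd_add, map_mul, hρ, hρ, hρ, Subgroup.coe_mul, map_mul]
  constructor
  · intro h s hs
    rw [← mk_mem_T_iff_restrictedCharacters hN, ← h] at hs
    obtain ⟨t, ht, hts⟩ := hs
    have htS := T_le_Tbar hI ht
    have hn : s * (⟨t, htS⟩ : Tbar G Ω)⁻¹ ∈ N.subgroupOf (Tbar G Ω) := by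
      rw [Subgroup.mem_subgroupOf, ← QuotientGroup.eq_one_iff]
      have hts' : (QuotientGroup.mk t : G ⧸ N) = QuotientGroup.mk (s : G) := hts
      simp [QuotientGroup.mk_mul, QuotientGroup.mk_inv, hts']
    refine ⟨_, hn, fun χ hχ => ?_⟩
    have h0 := (mem_T_iff_restrictedCharacters ⟨t, htS⟩).mp ht χ hχ
    have h1 := hmul χ hχ (s * (⟨t, htS⟩ : Tbar G Ω)⁻¹) ⟨t, htS⟩
    rw [inv_mul_cancel_right, h0, add_zero] at h1
    exact h1.symm
  · intro h
    refine le_antisymm ?_ ?_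
    · rintro _ ⟨t, ht, rfl⟩
      exact (mk_mem_T_iff_restrictedCharacters hN ⟨t, T_le_Tbar hI ht⟩).mpr fun χ hχ _ =>
        (mem_T_iff_restrictedCharacters ⟨t, T_le_Tbar hI ht⟩).mp ht χ hχ
    · intro y hy
      induction y using QuotientGroup.induction_on with | H g => ?_
      -- Assumption (I) for `G ⧸ N` places the representative `g` in `Tbar G Ω`, where the
      -- characters are defined.
      have hg := (mk_mem_Tbar_iff hN g).mp (T_le_Tbar hI hy)
      obtain ⟨n, hn, hns⟩ := h ⟨g, hg⟩ ((mk_mem_T_iff_restrictedCharacters hN ⟨g, hg⟩).mp hy)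
      refine ⟨((n⁻¹ * ⟨g, hg⟩ : Tbar G Ω) : G), ?_, ?_⟩
      · refine (mem_T_iff_restrictedCharacters _).mpr fun χ hχ => ?_
        have h1 := hmul χ hχ n (n⁻¹ * ⟨g, hg⟩)
        rw [mul_inv_cancel_left, hns χ hχ] at h1
        simpa using h1.symm
      · have hn1 : (QuotientGroup.mk (n : G) : G ⧸ N) = 1 :=
          (QuotientGroup.eq_one_iff _).mpr (Subgroup.mem_subgroupOf.mp hn)
        simp [QuotientGroup.mk_mul, QuotientGroup.mk_inv, hn1]

end Lifts

/-! ### Liftable pullbacks matched with restricted characters -/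

section Main

variable {p : ℕ} [NeZero p] {G : Type v} [Group G] [TopologicalSpace G] [IsTopologicalGroup G]
  (Ω : Set (CentralExtension.{u} p))

open inflationTrivializations

/-- The trivializations coming from a continuous homomorphism `ρ : G → U_ω`, its induced
homomorphism `G ⧸ Tbar(G) → Ubar_ω`, and a continuous section `s` of `U_ω → Ubar_ω`. -/
def liftTrivializations : Set (inflationTrivializations p (Tbar G Ω)) :=
  {x | ∃ ω ∈ Ω, ∃ (ρ : G →ₜ* ω.U) (ρbar : G ⧸ Tbar G Ω →ₜ* ω.Ubar) (s : C(ω.Ubar, ω.U))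
    (hs : ∀ y, ω.ext.rightHom (s y) = y), (∀ g : G, ω.proj (ρ g) = ρbar (QuotientGroup.mk g)) ∧
    x.1.2 = cocycles₂Map ρbar (ω.factorSet s hs) ∧
    ∀ g : G, ω.ext.inl (Multiplicative.ofAdd (x.1.1 g)) =
      ρ g * (s (ρbar (QuotientGroup.mk g)))⁻¹}

variable {Ω}

/-- Both `ρ` and `s ∘ ρbar` lie over `ρbar`, so their quotient `u` takes values in the central
`ℤ/p`. Multiplicativity of `ρ` then makes the inflated factor set the coboundary of `-u`. -/
theorem exists_liftTrivialization {ω : CentralExtension.{u} p} (hω : ω ∈ Ω) (ρ : G →ₜ* ω.U)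
    (ρbar : G ⧸ Tbar G Ω →ₜ* ω.Ubar) (h : ∀ g : G, ω.proj (ρ g) = ρbar (QuotientGroup.mk g)) :
    ∃ x ∈ liftTrivializations (G := G) Ω,
      toH2 x = H2Map ρbar ω.classifyingElement ∧
      ∀ t, ω.ext.inl (Multiplicative.ofAdd (restrict x t)) = ρ t := by
  obtain ⟨s, hs⟩ := ω.exists_section
  have hu : ∀ g : G, ∃ z : ZMod p, ω.ext.inl (Multiplicative.ofAdd z) =
      ρ g * (s (ρbar (QuotientGroup.mk g)))⁻¹ := by
    intro g
    have h1 : ρ g * (s (ρbar (QuotientGroup.mk g)))⁻¹ ∈ ω.ext.inl.range := by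
      rw [ω.ext.range_inl_eq_ker_rightHom, MonoidHom.mem_ker, map_mul, map_inv, hs, ← h]
      exact mul_inv_cancel _
    obtain ⟨z, hz⟩ := h1
    exact ⟨z.toAdd, hz⟩
  choose u hu using hu
  have hemb : Topology.IsClosedEmbedding
      (fun z : ZMod p => ω.ext.inl (Multiplicative.ofAdd z)) :=
    Continuous.isClosedEmbedding continuous_of_discreteTopology
      (ω.ext.inl_injective.comp Multiplicative.ofAdd.injective)
  have huc : Continuous u := by
    rw [hemb.isEmbedding.continuous_iff]
    have h2 : ((fun z : ZMod p => ω.ext.inl (Multiplicative.ofAdd z)) ∘ u) =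
        fun g : G => ρ g * (s (ρbar (QuotientGroup.mk g)))⁻¹ := funext hu
    have hc : Continuous fun g : G => ρbar (QuotientGroup.mk g : G ⧸ Tbar G Ω) :=
      ρbar.continuous_toFun.comp QuotientGroup.continuous_mk
    have hρ : Continuous ρ := ρ.continuous_toFun
    rw [h2]
    fun_prop
  have hcen : ∀ (z : ZMod p) (y : ω.U),
      y * ω.ext.inl (Multiplicative.ofAdd z) = ω.ext.inl (Multiplicative.ofAdd z) * y :=
    fun z y => Subgroup.mem_center_iff.mp (ω.central ⟨_, rfl⟩) y
  have hρu : ∀ g : G, ρ g = ω.ext.inl (Multiplicative.ofAdd (u g)) *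
      s (ρbar (QuotientGroup.mk g)) := fun g => by rw [hu]; group
  have hx : ((⟨u, huc⟩, cocycles₂Map ρbar (ω.factorSet s hs)) :
      C(G, ZMod p) × cocycles₂ p (G ⧸ Tbar G Ω)) ∈ inflationTrivializations p (Tbar G Ω) := by
    intro g k
    have key : (ω.factorSet s hs).1 (ρbar (QuotientGroup.mk g), ρbar (QuotientGroup.mk k)) +
        (u g + u k) = u (g * k) := by
      apply Multiplicative.ofAdd.injective
      apply ω.ext.inl_injective
      have hm := map_mul ρ g k
      rw [hρu g, hρu k] at hm
      rw [ofAdd_add, ofAdd_add, map_mul, map_mul, CentralExtension.inl_factorSet, hu (g * k), hm,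
        QuotientGroup.mk_mul, map_mul ρbar]
      have hg := hcen (u g) (s (ρbar (QuotientGroup.mk g)) * s (ρbar (QuotientGroup.mk k)) *
        (s (ρbar (QuotientGroup.mk g) * ρbar (QuotientGroup.mk k)))⁻¹)
      have hk := hcen (u k) (s (ρbar (QuotientGroup.mk g)) * s (ρbar (QuotientGroup.mk k)) *
        (s (ρbar (QuotientGroup.mk g) * ρbar (QuotientGroup.mk k)))⁻¹)
      have hk' := hcen (u k) (s (ρbar (QuotientGroup.mk g)))
      generalize ω.ext.inl (Multiplicative.ofAdd (u g)) = a at *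
      generalize ω.ext.inl (Multiplicative.ofAdd (u k)) = b at *
      generalize (s (ρbar (QuotientGroup.mk g) * ρbar (QuotientGroup.mk k))) = e at *
      generalize s (ρbar (QuotientGroup.mk g)) = c at *
      generalize s (ρbar (QuotientGroup.mk k)) = d at *
      calc c * d * e⁻¹ * (a * b) = (c * d * e⁻¹ * a) * b := by group
        _ = a * (c * d * e⁻¹ * b) := by rw [hg]; group
        _ = a * (b * c) * d * e⁻¹ := by rw [hk]; group
        _ = a * c * (b * d) * e⁻¹ := by rw [← hk']; group
    change (ω.factorSet s hs).1 (ρbar (QuotientGroup.mk g), ρbar (QuotientGroup.mk k)) =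
      u (g * k) - u g - u k
    linear_combination key
  refine ⟨⟨_, hx⟩, ⟨ω, hω, ρ, ρbar, s, hs, h, rfl, hu⟩, ?_, fun t => ?_⟩
  · rw [ω.classifyingElement_eq s hs]
    rfl
  · have ht : (QuotientGroup.mk (t : G) : G ⧸ Tbar G Ω) = 1 :=
      (QuotientGroup.eq_one_iff _).mpr t.2
    change ω.ext.inl (Multiplicative.ofAdd (u t - u 1)) = ρ t
    -- The section need not satisfy `s 1 = 1`; subtracting `u 1` cancels the factor `(s 1)⁻¹`.
    rw [ofAdd_sub, map_div, hu, hu, ht, QuotientGroup.mk_one, map_one ρ, one_mul,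
      mul_div_cancel_right]

theorem toH2_image_liftTrivializations :
    toH2 '' liftTrivializations (G := G) Ω = liftablePullbacks Ω (Tbar G Ω) := by
  ext c
  constructor
  · rintro ⟨x, ⟨ω, hω, ρ, ρbar, s, hs, h, hx, _⟩, rfl⟩
    refine ⟨ω, hω, ρbar, ⟨ρ, h⟩, ?_⟩
    rw [ω.classifyingElement_eq s hs]
    exact congrArg QuotientAddGroup.mk hx
  · rintro ⟨ω, hω, ρbar, ⟨ρ, h⟩, rfl⟩
    obtain ⟨x, hx, hc, _⟩ := exists_liftTrivialization hω ρ ρbar h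
    exact ⟨x, hx, hc⟩

theorem restrict_image_liftTrivializations :
    restrict '' liftTrivializations (G := G) Ω = restrictedCharacters G Ω := by
  ext χ
  constructor
  · rintro ⟨x, ⟨ω, hω, ρ, ρbar, s, hs, _, _, hx⟩, rfl⟩
    refine ⟨ω, hω, ρ, fun t => ?_⟩
    have ht : (QuotientGroup.mk (t : G) : G ⧸ Tbar G Ω) = 1 :=
      (QuotientGroup.eq_one_iff _).mpr t.2
    change ω.ext.inl (Multiplicative.ofAdd (x.1.1 t - x.1.1 1)) = ρ t
    rw [ofAdd_sub, map_div, hx, hx, ht, QuotientGroup.mk_one, map_one ρ, one_mul,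
      mul_div_cancel_right]
  · rintro ⟨ω, hω, ρ, hρ⟩
    obtain ⟨x, hx, _, hr⟩ := exists_liftTrivialization hω ρ
      ⟨QuotientGroup.lift (Tbar G Ω) (ω.proj.comp ρ).toMonoidHom fun n hn =>
        (mem_Tbar_iff Ω).mp hn ω hω (ω.proj.comp ρ),
        (ω.proj.comp ρ).continuous_toFun.quotient_lift _⟩ fun g => rfl
    refine ⟨x, hx, funext fun t => Multiplicative.ofAdd.injective (ω.ext.inl_injective ?_)⟩
    rw [hr, hρ]

end Main

end KernelGenerating

open KernelGenerating KernelGenerating.inflationTrivializations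

theorem theorem7p5 {p : ℕ} [Fact p.Prime]
    (Ω : Set (KernelGenerating.CentralExtension.{u} p)) (hΩ : Ω.Nonempty)
    (hI : ∀ ω ∈ Ω, ω.AssumptionI) (hII : ∀ ω ∈ Ω, ω.AssumptionII)
    {G : Type v} [Group G] [TopologicalSpace G] [IsTopologicalGroup G] [CompactSpace G]
    [TotallyDisconnectedSpace G]
    (N : Subgroup G) [N.Normal] (hN : IsClosed (N : Set G))
    (hNT : N ≤ KernelGenerating.Tbar G Ω) :
    [(KernelGenerating.T G Ω).map (QuotientGroup.mk' N) = KernelGenerating.T (G ⧸ N) Ω,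
      KernelGenerating.KernelGeneratingCondition Ω hNT,
      AddSubgroup.closure
          (KernelGenerating.liftablePullbacks Ω (KernelGenerating.Tbar G Ω) ∩
            (KernelGenerating.inflation p hNT).ker) =
        AddSubgroup.closure
            (KernelGenerating.liftablePullbacks Ω (KernelGenerating.Tbar G Ω)) ⊓
          (KernelGenerating.inflation p hNT).ker].TFAE := by
  have hC : C Ω hNT = AddSubgroup.closure (liftablePullbacks Ω (Tbar G Ω)) ⊓
      (inflation p hNT).ker := by
    rw [C, ← AddMonoidHom.comap_ker, AddSubgroup.map_comap_eq, AddSubgroup.range_subtype]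
    rfl
  tfae_have 2 ↔ 3 := by
    rw [KernelGeneratingCondition, hC]
    rfl
  tfae_have 1 ↔ 3 := by
    have : CompactSpace (Tbar G Ω) :=
      isCompact_iff_compactSpace.mp (isClosed_Tbar Ω).isCompact
    have hS := character_eq_zero_of_mem_Tbar (G := G) hΩ hII
    let L : AddSubgroup (Tbar G Ω → ZMod p) :=
      ⨅ n ∈ N.subgroupOf (Tbar G Ω), (Pi.evalAddMonoidHom _ n).ker
    have hL : ∀ χ, χ ∈ L ↔ ∀ n ∈ N.subgroupOf (Tbar G Ω), χ n = 0 := by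
      intro χ
      simp only [L, AddSubgroup.mem_iInf, AddMonoidHom.mem_ker, Pi.evalAddMonoidHom_apply]
    have hcomap : (inflation p hNT).ker.comap toH2 = L.comap restrict := by
      ext x
      rw [AddSubgroup.mem_comap, AddSubgroup.mem_comap, AddMonoidHom.mem_ker, hL]
      exact inflation_toH2_eq_zero_iff hS hNT x
    -- Condition (c) is carried from classes to characters of `Tbar G Ω`, then dualized into the
    -- criterion for (a).
    rw [← toH2_image_liftTrivializations,
      closure_image_inter_eq_iff toH2 restrict (ker_toH2 hS) _ _ L hcomap,
      closure_inter_annihilator_eq_iff _ (by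
        rintro _ ⟨x, _, rfl⟩
        exact ⟨continuous_restrict x, restrict_mul x⟩)
        (N.subgroupOf (Tbar G Ω)) (hN.preimage continuous_subtype_val) L hL,
      restrict_image_liftTrivializations, map_T_eq_iff Ω hI hNT]
    simp only [hL]
  tfae_finish
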